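/- Let $\mathbb O$ be the octonions with basis $e_0=1,e_1,\dots,e_7$, where $e_ie_i=-1$ for $i\ge 1$ and $e_ae_b=e_c=-e_be_a$ for all cyclic rotations $(a,b,c)$ of the triples $(123),(145),(176),(246),(257),(347),(365)$; let $\overline{x}$, $\operatorname{Re}x$ and $|x|$ be conjugate, real part and modulus, and $\mathbb S=\{J\in\mathbb O:\operatorname{Re}J=0,\ |J|=1\}$. An $\mathbb O$-bimodule is a real vector space $M$ with real-bilinear unital left and right multiplications by $\mathbb O$ such that $[p,q,x]=[q,x,p]=[x,p,q]=-[q,p,x]$ for all $p,q\in\mathbb O$, $x\in M$, where $[a,b,c]=(ab)c-a(bc)$. Its real part is $\operatorname{Re}M=\{m\in M:[p,q,m]=0\ \ \forall p,q\in\mathbb O\}$, with projection $\operatorname{Re}:M\to\operatorname{Re}M$, $\operatorname{Re}m=\frac5{12}m-\frac1{12}\sum_{i=1}^7 e_ime_i$. A real-linear map $f:M\to M'$ of $\mathbb O$-bimodules is right para-linear if $\operatorname{Re}B_p(f,x)=0$ for all $p\in\mathbb O$, $x\in M$, where $B_p(f,x)=f(x)p-f(xp)$. A Hilbert $\mathbb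 O$-bimodule is an $\mathbb O$-bimodule $H$ with a real-bilinear map $\langle\cdot,\cdot\rangle:H\times H\to\mathbb O$ such that $\operatorname{Re}(\langle u,x\rangle p-\langle u,xp\rangle)=0$ and $\langle u,x\rangle=\overline{\langle x,u\rangle}$ for all $u,x\in H$, $p\in\mathbb O$, such that $\langle u,u\rangle$ is a nonnegative real number which vanishes only for $u=0$, and such that $H$ is complete in the norm $\|u\|=\sqrt{\langle u,u\rangle}$. Its slice cone is $\mathbb C(H)=\bigcup_{J\in\mathbb S}(\operatorname{Re}H+J\operatorname{Re}H)$. For a bounded real-linear operator $T:H\to H$ and $x,y\in H$ put $$(\langle\cdot,y\rangle\circledcirc T)(x)=\overline{\sum_{i=0}^7 e_i\operatorname{Re}\langle y,T(x\overline{e_i})\rangle},\qquad [y,T,x]=(\langle\cdot,y\rangle\circledcirc T)(x)-\langle Tx,y\rangle ;$$ equivalently, $[y,T,x]=-\sum_{i=1}^7 e_i\operatorname{Re}\langle y,B_{e_i}(T,x)\rangle$. The (corrected) adjoint $T^*:H\to H$ is the map for which $T^*y$ is the unique vector with $$\langle x,T^*y\rangle=\langle Tx,y\rangle+[y,T,x]\qquad\text{for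 all }x\in H .$$ **Theorem.** Let $H$ be a Hilbert $\mathbb O$-bimodule and $T:H\to H$ a bounded right para-linear operator. Then $T$ is self-adjoint, i.e. $T=T^*$, if and only if $\langle Tx,x\rangle\in\mathbb R$ for every $x\in\mathbb C(H)$. -/

import Mathlib

noncomputable section

/-- The octonions `𝕆`, as real coordinate vectors with respect to the basis
`e₀ = 1, e₁, …, e₇`. -/
def Octonion : Type := Fin 8 → ℝ

namespace Octonion

instance : AddCommGroup Octonion := inferInstanceAs (AddCommGroup (Fin 8 → ℝ))

instance : Module ℝ Octonion := inferInstanceAs (Module ℝ (Fin 8 → ℝ))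

/-- The basis `e₀, …, e₇`. -/
def e (i : Fin 8) : Octonion := fun j => if j = i then 1 else 0

instance : One Octonion := ⟨e 0⟩

/-- Octonion multiplication: `e₀ = 1` is the unit, `eᵢ eᵢ = -1` for `i ≥ 1`, and
`e_a e_b = e_c = -e_b e_a` for every cyclic rotation `(a b c)` of one of the oriented triples
`(123), (145), (176), (246), (257), (347), (365)`. -/
instance : Mul Octonion := ⟨fun x y => ![
  x 0 * y 0 - x 1 * y 1 - x 2 * y 2 - x 3 * y 3 - x 4 * y 4 - x 5 * y 5 - x 6 * y 6 - x 7 * y 7,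
  x 0 * y 1 + x 1 * y 0
    + (x 2 * y 3 - x 3 * y 2) + (x 4 * y 5 - x 5 * y 4) + (x 7 * y 6 - x 6 * y 7),
  x 0 * y 2 + x 2 * y 0
    + (x 3 * y 1 - x 1 * y 3) + (x 4 * y 6 - x 6 * y 4) + (x 5 * y 7 - x 7 * y 5),
  x 0 * y 3 + x 3 * y 0
    + (x 1 * y 2 - x 2 * y 1) + (x 4 * y 7 - x 7 * y 4) + (x 6 * y 5 - x 5 * y 6),
  x 0 * y 4 + x 4 * y 0
    + (x 5 * y 1 - x 1 * y 5) + (x 6 * y 2 - x 2 * y 6) + (x 7 * y 3 - x 3 * y 7),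
  x 0 * y 5 + x 5 * y 0
    + (x 1 * y 4 - x 4 * y 1) + (x 7 * y 2 - x 2 * y 7) + (x 3 * y 6 - x 6 * y 3),
  x 0 * y 6 + x 6 * y 0
    + (x 1 * y 7 - x 7 * y 1) + (x 2 * y 4 - x 4 * y 2) + (x 5 * y 3 - x 3 * y 5),
  x 0 * y 7 + x 7 * y 0
    + (x 6 * y 1 - x 1 * y 6) + (x 2 * y 5 - x 5 * y 2) + (x 3 * y 4 - x 4 * y 3)]⟩

/-- The real part `x₀` of an octonion. -/
def re (x : Octonion) : ℝ := x 0

/-- Octonionic conjugation. -/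
def conj (x : Octonion) : Octonion := fun i => if i = 0 then x i else -x i

/-- The modulus `|x| = √(x x̄)`, where `x x̄` is a nonnegative real number. -/
def abs (x : Octonion) : ℝ := Real.sqrt (re (x * conj x))

/-- `x` lies in `ℝ ⊆ 𝕆`. -/
def IsReal (x : Octonion) : Prop := ∃ r : ℝ, x = r • (1 : Octonion)

/-- The sphere `𝕊` of imaginary units. -/
def unitImaginary : Set Octonion := {J | re J = 0 ∧ abs J = 1}

end Octonion

/-- An `𝕆`-bimodule: a real vector space with real-bilinear unital left and right
multiplications by octonions such that
`[p, q, x] = [q, x, p] = [x, p, q] = -[q, p, x]`, where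
`[p, q, x] = (pq)x - p(qx)`, `[q, x, p] = (qx)p - q(xp)`, `[x, p, q] = (xp)q - x(pq)`.
In particular it is a right `𝕆`-module: `[x, p, q] = -[x, q, p]`. -/
class OctonionBimodule (M : Type*) [AddCommGroup M] [Module ℝ M] where
  /-- left multiplication `lmul p x = p x` -/
  lmul : Octonion →ₗ[ℝ] M →ₗ[ℝ] M
  /-- right multiplication `rmul x p = x p` -/
  rmul : M →ₗ[ℝ] Octonion →ₗ[ℝ] M
  one_lmul : ∀ x, lmul 1 x = x
  rmul_one : ∀ x, rmul x 1 = x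
  left_eq_middle : ∀ (p q : Octonion) (x : M),
    lmul (p * q) x - lmul p (lmul q x) = rmul (lmul q x) p - lmul q (rmul x p)
  left_eq_right : ∀ (p q : Octonion) (x : M),
    lmul (p * q) x - lmul p (lmul q x) = rmul (rmul x p) q - rmul x (p * q)
  left_alternating : ∀ (p q : Octonion) (x : M),
    lmul (p * q) x - lmul p (lmul q x) = -(lmul (q * p) x - lmul q (lmul p x))

infixr:75 " •ₗ " => OctonionBimodule.lmul
infixl:75 " •ᵣ " => OctonionBimodule.rmul

namespace OctonionBimodule

variable {M M' : Type*} [AddCommGroup M] [Module ℝ M] [OctonionBimodule M]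
  [AddCommGroup M'] [Module ℝ M'] [OctonionBimodule M']

/-- The real part `Re M = {m | [p, q, m] = 0 for all p, q}` of a bimodule. -/
def realPart (M : Type*) [AddCommGroup M] [Module ℝ M] [OctonionBimodule M] : Set M :=
  {m | ∀ p q : Octonion, (p * q) •ₗ m - p •ₗ (q •ₗ m) = 0}

/-- The projection `Re : M → Re M`, given by `Re m = (5/12) m - (1/12) ∑_{i=1}^7 eᵢ m eᵢ`. -/
def reProj (m : M) : M :=
  (5 / 12 : ℝ) • m
    - (1 / 12 : ℝ) • ∑ i ∈ Finset.univ.erase (0 : Fin 8), (Octonion.e i •ₗ m) •ᵣ Octonion.e i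

/-- The second right associator `B_p(f, x) = f(x) p - f(x p)`. -/
def secondAssoc (f : M → M') (p : Octonion) (x : M) : M' := f x •ᵣ p - f (x •ᵣ p)

/-- A map `f` is right para-linear if it is real-linear and `Re B_p(f, x) = 0` for all `p`, `x`. -/
def IsRightParaLinear (f : M → M') : Prop :=
  IsLinearMap ℝ f ∧ ∀ (p : Octonion) (x : M), reProj (secondAssoc f p x) = 0

/-- The slice cone `⋃_{J ∈ 𝕊} (Re M + J Re M)`. -/
def sliceCone (M : Type*) [AddCommGroup M] [Module ℝ M] [OctonionBimodule M] : Set M :=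
  ⋃ J ∈ Octonion.unitImaginary, {z | ∃ u ∈ realPart M, ∃ v ∈ realPart M, z = u + J •ₗ v}

end OctonionBimodule

/-- A pre-Hilbert `𝕆`-bimodule: an `𝕆`-bimodule with an `𝕆`-valued real-bilinear inner product
which is para-linear in the second variable, Hermitian and positive definite; its norm is
`‖u‖ = √⟨u, u⟩` (so positivity is the fact that `⟨u, u⟩` is the real number `‖u‖ ^ 2`).
A Hilbert `𝕆`-bimodule is one which is moreover complete, `[CompleteSpace H]`. -/
class PreHilbertOctonionBimodule (H : Type*) [NormedAddCommGroup H] [NormedSpace ℝ H]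
    extends OctonionBimodule H where
  /-- the octonion-valued inner product -/
  oinner : H →ₗ[ℝ] H →ₗ[ℝ] Octonion
  oinner_paraLinear : ∀ (u x : H) (p : Octonion),
    Octonion.re (oinner u x * p - oinner u (x •ᵣ p)) = 0
  oinner_conj : ∀ u v, oinner u v = Octonion.conj (oinner v u)
  oinner_self : ∀ u, oinner u u = (‖u‖ ^ 2) • (1 : Octonion)

notation "⟪" u ", " v "⟫ₒ" => PreHilbertOctonionBimodule.oinner u v

namespace PreHilbertOctonionBimodule

open OctonionBimodule

variable {H : Type*} [NormedAddCommGroup H] [NormedSpace ℝ H] [PreHilbertOctonionBimodule H]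

/-- The regular composition `(f ⊚ g)(x) = ∑_{i=0}^7 eᵢ Re f(g(x ēᵢ))` of an octonion-valued
functional `f` (to be used for right para-linear `f`) with a real-linear map `g`. -/
def regComp (f : H → Octonion) (g : H → H) (x : H) : Octonion :=
  ∑ i : Fin 8, Octonion.re (f (g (x •ᵣ Octonion.conj (Octonion.e i)))) • Octonion.e i

/-- The triple associator `[y, T, x] = (⟨·, y⟩ ⊚ T)(x) - ⟨T x, y⟩`. Here `⟨·, y⟩` is the conjugate
of the right para-linear functional `⟨y, ·⟩`, and accordingly `⟨·, y⟩ ⊚ T` is the conjugate of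
`⟨y, ·⟩ ⊚ T`. -/
def tripleAssoc (y : H) (T : H → H) (x : H) : Octonion :=
  Octonion.conj (regComp (fun w => ⟪y, w⟫ₒ) T x) - ⟪T x, y⟫ₒ

/-- The underlying real inner product `⟨u, v⟩_ℝ = Re ⟨u, v⟩`. -/
@[reducible] def realInnerProductSpace (H : Type*) [NormedAddCommGroup H] [NormedSpace ℝ H]
    [PreHilbertOctonionBimodule H] : InnerProductSpace ℝ H where
  inner u v := Octonion.re ⟪u, v⟫ₒ
  norm_sq_eq_re_inner u := by
    rw [oinner_self]
    change ‖u‖ ^ 2 = ‖u‖ ^ 2 * Octonion.e 0 0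
    simp [Octonion.e]
  conj_inner_symm u v := by
    rw [oinner_conj u v]
    simp [Octonion.re, Octonion.conj]
  add_left u v w := by
    simp only [map_add, LinearMap.add_apply]
    rfl
  smul_left u v r := by
    simp only [map_smul, LinearMap.smul_apply]
    rfl

theorem re_sub_eq_zero_iff (a b : Octonion) : Octonion.re (a - b) = 0 ↔ a.re = b.re :=
  sub_eq_zero (a := a 0) (b := b 0)

theorem conj_conj (a : Octonion) : a.conj.conj = a := by
  funext i
  by_cases h : i = 0 <;> simp [Octonion.conj, h]

theorem sum_re_mul_conj_e (a : Octonion) :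
    ∑ i : Fin 8, Octonion.re (a * Octonion.conj (Octonion.e i)) • Octonion.e i = a := by
  have key : ∀ i : Fin 8, Octonion.re (a * Octonion.conj (Octonion.e i)) = a i := by
    intro i
    change a 0 * Octonion.conj (Octonion.e i) 0 - a 1 * Octonion.conj (Octonion.e i) 1
      - a 2 * Octonion.conj (Octonion.e i) 2 - a 3 * Octonion.conj (Octonion.e i) 3
      - a 4 * Octonion.conj (Octonion.e i) 4 - a 5 * Octonion.conj (Octonion.e i) 5
      - a 6 * Octonion.conj (Octonion.e i) 6 - a 7 * Octonion.conj (Octonion.e i) 7 = a i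
    fin_cases i <;> simp [Octonion.conj, Octonion.e]
  funext j
  simp only [key]
  have h : ∀ f : Fin 8 → Octonion, (∑ i, f i) j = ∑ i, f i j := fun f =>
    Finset.sum_apply (M := fun _ : Fin 8 => ℝ) j Finset.univ f
  rw [h]
  have h2 : ∀ i, (a i • Octonion.e i) j = a i * (if j = i then 1 else 0) := fun i => rfl
  simp only [h2, mul_ite, mul_one, mul_zero]
  exact (Finset.sum_ite_eq (M := ℝ) Finset.univ j (fun i => a i)).trans
    (if_pos (Finset.mem_univ j))

/-- Every functional `⟨·, y⟩ ⊚ T` is represented by a unique vector. -/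
theorem existsUnique_adjoint [CompleteSpace H] (T : H →L[ℝ] H) (y : H) :
    ∃! z : H, ∀ x : H, ⟪x, z⟫ₒ = ⟪T x, y⟫ₒ + tripleAssoc y T x := by
  let _ : InnerProductSpace ℝ H := realInnerProductSpace H
  refine ⟨ContinuousLinearMap.adjoint T y, fun x => ?_, fun z hz => ?_⟩
  · have h1 : ∀ w : H, Octonion.re ⟪ContinuousLinearMap.adjoint T y, w⟫ₒ
        = Octonion.re ⟪y, T w⟫ₒ := fun w => ContinuousLinearMap.adjoint_inner_left T w y
    rw [tripleAssoc, add_sub_cancel, oinner_conj]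
    congr 1
    rw [regComp, ← sum_re_mul_conj_e ⟪ContinuousLinearMap.adjoint T y, x⟫ₒ]
    refine Finset.sum_congr rfl fun i _ => ?_
    rw [← h1, (re_sub_eq_zero_iff _ _).1 (oinner_paraLinear _ _ _)]
  · have h2 : ∀ x : H, ⟪z, x⟫ₒ = regComp (fun w => ⟪y, w⟫ₒ) T x := fun x => by
      rw [oinner_conj, hz x, tripleAssoc, add_sub_cancel, conj_conj]
    refine ext_inner_right ℝ fun x => ?_
    rw [ContinuousLinearMap.adjoint_inner_left]
    change Octonion.re ⟪z, x⟫ₒ = Octonion.re ⟪y, T x⟫ₒ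
    have h0 : Octonion.conj (Octonion.e 0) = 1 := by
      funext i
      by_cases h : i = 0 <;> simp [Octonion.conj, Octonion.e, h] <;>
        change _ = Octonion.e 0 _ <;> simp [Octonion.e, h]
    have h3 : ∀ f : Fin 8 → Octonion, Octonion.re (∑ i, f i) = ∑ i, f i 0 := fun f =>
      Finset.sum_apply (M := fun _ : Fin 8 => ℝ) 0 Finset.univ f
    have h4 : ∀ (r : ℝ) (i : Fin 8), (r • Octonion.e i) 0 = r * (if 0 = i then 1 else 0) :=
      fun r i => rfl
    rw [h2, regComp, h3]
    simp only [h4, mul_ite, mul_one, mul_zero, Finset.sum_ite_eq, Finset.mem_univ, if_true, h0]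
    rw [rmul_one]

/-- The adjoint `T*`: `T* y` is the unique vector with `⟨x, T* y⟩ = ⟨T x, y⟩ + [y, T, x]` for
all `x`. -/
def octAdjoint [CompleteSpace H] (T : H →L[ℝ] H) (y : H) : H :=
  (existsUnique_adjoint T y).choose

theorem oinner_octAdjoint [CompleteSpace H] (T : H →L[ℝ] H) (x y : H) :
    ⟪x, octAdjoint T y⟫ₒ = ⟪T x, y⟫ₒ + tripleAssoc y T x :=
  (existsUnique_adjoint T y).choose_spec.1 x

/-- `T` is self-adjoint if `T = T*`. -/
def IsOctSelfAdjoint [CompleteSpace H] (T : H →L[ℝ] H) : Prop := ⇑T = octAdjoint T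

end PreHilbertOctonionBimodule

end

/-! Everything reduces to the real form `rip`, that is (x, y) = Re ⟨x, y⟩. The corrected adjoint is
the adjoint for this form (`rip_octAdjoint`), so T = T* means (Tx, y) = (x, Ty). An octonion is real
exactly when its product with every imaginary k has real part 0, so ⟨Tx, x⟩ is real iff (Tx, xk) = 0
for all such k.

A bimodule is generated over 𝕆 by its real elements (`exists_eq_sum_lmul`), which commute and
associate with the octonions. Para-linearity allows right factors to pass through T when paired with
real vectors (`rip_map_rmul`). Hence T is governed by B(u, r, v) = (T(ur), v) with u, v real and r ∈
𝕆, and symmetry of T amounts to B(u, r, v) = B(v, r̄, u) (`symmetric_of_realPart`). On x = u + Jv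
the condition (Tx, xk) = 0 is a sum of four values of B (`rip_map_slice`). Symmetry makes the
diagonal terms vanish and the cross terms cancel. Conversely, v = 0 and polarization give the law
for imaginary r, and k = J gives it for r = 1.

The substantial input is the generation by real elements. To each line of the Fano plane belongs the
product w of its three left multiplications, an involution equal to -1 exactly on the vectors with
which that line associates. For three lines through a point, w₁w₂w₃ = -1 (`IsFanoLine.mul_eq_neg`).
The left structure alone does not force this sign: letting p act as p̄ replaces w by -w. Right
multiplication excludes that case. Three lines then control all seven, and averaging over signs
decomposes every vector. -/

section Clifford

/-! ### Clifford relations and Fano lines -/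

variable {A : Type*} [Ring A]

theorem anticomm_mul_mul {d x y z : A} (hx : d * x = -(x * d)) (hy : d * y = -(y * d))
    (hz : d * z = -(z * d)) : d * (x * y * z) = -(x * y * z * d) := by
  linear_combination (norm := noncomm_ring) hx * y * z - x * hy * z + x * y * hz

theorem comm_mul_mul_of_anticomm {a b c d : A} (ha : d * a = -(a * d)) (hb : d * b = -(b * d))
    (hc : d * c = c * d) : d * (a * b * c) = a * b * c * d := by
  linear_combination (norm := noncomm_ring) ha * b * c - a * hb * c + a * b * hc

theorem eq_of_add_self [Algebra ℝ A] {x y : A} (h : x + x = y + y) : x = y := by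
  have h2 : (2 : ℝ) • x = (2 : ℝ) • y := by rw [two_smul, two_smul, h]
  exact smul_right_injective A two_ne_zero h2

/-- Anticommuting square roots `a, b, c` of `-1`, together with a square root `r` of `-1` whose
commutators with them are those of a right multiplication in an alternative algebra. -/
structure IsFanoLine (r a b c : A) : Prop where
  sq_a : a * a = -1
  sq_b : b * b = -1
  sq_c : c * c = -1
  ab : a * b = -(b * a)
  ac : a * c = -(c * a)
  bc : b * c = -(c * b)
  sq_r : r * r = -1
  ra : r * a = a * r
  rb : r * b - b * r = c - a * b
  rc : r * c - c * r = -b - a * c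

namespace IsFanoLine

variable {r a b c : A}

/-- On the +1 part of the involution abc, right multiplication acts as minus left multiplication:
the conjugate behaviour that has to be excluded. -/
theorem right_mul [Algebra ℝ A] (h : IsFanoLine r a b c) :
    r * (1 + a * b * c) = -(a * (1 + a * b * c)) := by
  -- Since r² = -1 is central, r anticommutes with the commutator [r, b] = c - ab.
  have h1 : r * (c - a * b) = -(c - a * b) * r := by
    linear_combination (norm := noncomm_ring) h.sq_r * b - b * h.sq_r - r * h.rb - h.rb * r
  have h2 : r * (c - a * b) - (c - a * b) * r = -(b + a * c) - (b + a * c) := by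
    linear_combination (norm := noncomm_ring) h.rc - h.ra * b - a * h.rb + h.sq_a * b
  have h3 : r * (c - a * b) = -(b + a * c) := eq_of_add_self (by
    linear_combination (norm := noncomm_ring) h2 + h1)
  linear_combination (norm := noncomm_ring) r * h.sq_c - h3 * c + a * h.sq_c + h.sq_a * b * c

theorem sq (h : IsFanoLine r a b c) : a * b * c * (a * b * c) = 1 := by
  linear_combination (norm := noncomm_ring)
    a * b * h.ac * b * c - a * h.ab * c * b * c + h.sq_a * b * c * b * c - b * h.bc * c
      + h.sq_b * c * c - h.sq_c

theorem a_comm (h : IsFanoLine r a b c) : a * (a * b * c) = a * b * c * a := by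
  linear_combination (norm := noncomm_ring) a * h.ab * c - a * b * h.ac

theorem b_comm (h : IsFanoLine r a b c) : b * (a * b * c) = a * b * c * b := by
  linear_combination (norm := noncomm_ring) h.ab * b * c - a * b * h.bc

theorem c_comm (h : IsFanoLine r a b c) : c * (a * b * c) = a * b * c * c :=
  comm_mul_mul_of_anticomm (by rw [h.ac, neg_neg]) (by rw [h.bc, neg_neg]) rfl

theorem assoc_mul (h : IsFanoLine r a b c) : (c - a * b) * (1 - a * b * c) = 0 := by
  linear_combination (norm := noncomm_ring) -h.ac * b * c + a * h.bc * c - a * b * h.sq_c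
    + a * h.ab * b * c - h.sq_a * b * b * c + h.sq_b * c

variable {b₁ c₁ b₂ c₂ b₃ c₃ : A}

theorem comm (h₂ : IsFanoLine r a b₂ c₂)
    (hb : b₁ * (a * b₂ * c₂) = -(a * b₂ * c₂ * b₁))
    (hc : c₁ * (a * b₂ * c₂) = -(a * b₂ * c₂ * c₁)) :
    a * b₁ * c₁ * (a * b₂ * c₂) = a * b₂ * c₂ * (a * b₁ * c₁) := by
  have ha := h₂.a_comm
  linear_combination (norm := noncomm_ring) a * b₁ * hc - a * hb * c₁ + ha * b₁ * c₁

/-- On the joint eigenspace with signs (+, -, -), r = -a because w₁ = 1, and r commutes with b₂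
because w₂ = -1. But b₂ moves this space into w₃ = 1, where again r = -a. So a would commute with b₂
there, while the two anticommute and are invertible. -/
theorem mul_mul_eq_zero [Algebra ℝ A] (h₁ : IsFanoLine r a b₁ c₁) (h₂ : IsFanoLine r a b₂ c₂)
    (h₃ : IsFanoLine r a b₃ c₃) (h12 : Commute (a * b₁ * c₁) (a * b₂ * c₂))
    (h13 : Commute (a * b₁ * c₁) (a * b₃ * c₃)) (h23 : Commute (a * b₂ * c₂) (a * b₃ * c₃))
    (hb1 : b₂ * (a * b₁ * c₁) = -(a * b₁ * c₁ * b₂))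
    (hb3 : b₂ * (a * b₃ * c₃) = -(a * b₃ * c₃ * b₂)) :
    (1 + a * b₁ * c₁) * (1 - a * b₂ * c₂) * (1 - a * b₃ * c₃) = 0 := by
  have r1 := h₁.right_mul
  have r3 := h₃.right_mul
  have d2 := h₂.assoc_mul
  have hb2 := h₂.b_comm
  have h12' := h12.eq
  have h13' := h13.eq
  have h23' := h23.eq
  have rb := h₂.rb
  have hab := h₂.ab
  have ha := h₂.sq_a
  have hb := h₂.sq_b
  clear h12 h13 h23
  rw [← sub_eq_zero] at r1 r3
  generalize a * b₁ * c₁ = w₁ at *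
  generalize a * b₂ * c₂ = w₂ at *
  generalize a * b₃ * c₃ = w₃ at *
  obtain ⟨E, hE⟩ : ∃ E, E = (1 + w₁) * (1 - w₂) * (1 - w₃) := ⟨_, rfl⟩
  rw [← hE]
  have e1 : r * E = -(a * E) := by
    rw [hE]
    linear_combination (norm := noncomm_ring) r1 * (1 - w₂) * (1 - w₃)
  have e2 : (c₂ - a * b₂) * E = 0 := by
    have : E = (1 - w₂) * ((1 + w₁) * (1 - w₃)) := by
      rw [hE]
      linear_combination (norm := noncomm_ring) -h12' * (1 - w₃)
    rw [this, ← mul_assoc, d2, zero_mul]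
  have e3 : b₂ * E = (1 + w₃) * ((1 - w₁) * (1 - w₂) * b₂) := by
    have : (1 + w₃) * ((1 - w₁) * (1 - w₂)) = (1 - w₁) * (1 - w₂) * (1 + w₃) := by
      linear_combination (norm := noncomm_ring) h13' * (1 - w₂) - w₁ * h23' + h23'
    rw [← mul_assoc (1 + w₃), this, hE]
    linear_combination (norm := noncomm_ring) hb1 * (1 - w₂) * (1 - w₃)
      - (1 - w₁) * hb2 * (1 - w₃) - (1 - w₁) * (1 - w₂) * hb3
  have e4 : r * (b₂ * E) = -(a * (b₂ * E)) := by
    rw [e3]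
    linear_combination (norm := noncomm_ring) r3 * (1 - w₁) * (1 - w₂) * b₂
  have e5 : a * b₂ * E = 0 := eq_of_add_self (by
    linear_combination (norm := noncomm_ring) - e2 - rb * E + e4 - b₂ * e1 + hab * E)
  linear_combination (norm := noncomm_ring) b₂ * a * e5 - b₂ * ha * b₂ * E + hb * E

/-- The sign patterns with product +1 all vanish: those with one plus by `mul_mul_eq_zero`, and (+,
+, +) because b₁ carries it to (+, -, -). The four corresponding products add up to 4(1 + w₁w₂w₃).
-/
theorem mul_eq_neg [Algebra ℝ A] (h₁ : IsFanoLine r a b₁ c₁) (h₂ : IsFanoLine r a b₂ c₂)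
    (h₃ : IsFanoLine r a b₃ c₃)
    (bb12 : b₁ * b₂ = -(b₂ * b₁)) (bc12 : b₁ * c₂ = -(c₂ * b₁))
    (cb12 : c₁ * b₂ = -(b₂ * c₁)) (cc12 : c₁ * c₂ = -(c₂ * c₁))
    (bb13 : b₁ * b₃ = -(b₃ * b₁)) (bc13 : b₁ * c₃ = -(c₃ * b₁))
    (cb13 : c₁ * b₃ = -(b₃ * c₁)) (cc13 : c₁ * c₃ = -(c₃ * c₁))
    (bb23 : b₂ * b₃ = -(b₃ * b₂)) (bc23 : b₂ * c₃ = -(c₃ * b₂))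
    (cb23 : c₂ * b₃ = -(b₃ * c₂)) (cc23 : c₂ * c₃ = -(c₃ * c₂)) :
    a * b₁ * c₁ * (a * b₂ * c₂) = -(a * b₃ * c₃) := by
  have sw : ∀ {x y : A}, x * y = -(y * x) → y * x = -(x * y) := fun h => by rw [h, neg_neg]
  have k12 := anticomm_mul_mul (sw h₁.ab) bb12 bc12
  have k12' := anticomm_mul_mul (sw h₁.ac) cb12 cc12
  have k13 := anticomm_mul_mul (sw h₁.ab) bb13 bc13
  have k13' := anticomm_mul_mul (sw h₁.ac) cb13 cc13
  have k23 := anticomm_mul_mul (sw h₂.ab) bb23 bc23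
  have k23' := anticomm_mul_mul (sw h₂.ac) cb23 cc23
  have k21 := anticomm_mul_mul (sw h₂.ab) (sw bb12) (sw cb12)
  have c12 : Commute _ _ := h₂.comm k12 k12'
  have c13 : Commute _ _ := h₃.comm k13 k13'
  have c23 : Commute _ _ := h₃.comm k23 k23'
  have z1 := h₁.mul_mul_eq_zero h₂ h₃ c12 c13 c23 k21 k23
  have z2 := h₂.mul_mul_eq_zero h₁ h₃ c12.symm c23 c13 k12 k13
  have z3 := h₃.mul_mul_eq_zero h₁ h₂ c13.symm c23.symm c12 k13 k12
  have sqb := h₁.sq_b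
  have kb := h₁.b_comm
  have s3 := h₃.sq
  have h12 := c12.eq
  have h13 := c13.eq
  have h23 := c23.eq
  clear c12 c13 c23
  generalize a * b₁ * c₁ = w₁ at *
  generalize a * b₂ * c₂ = w₂ at *
  generalize a * b₃ * c₃ = w₃ at *
  have z0 : (1 + w₁) * (1 + w₂) * (1 + w₃) = 0 := by
    have : b₁ * ((1 + w₁) * (1 + w₂) * (1 + w₃)) = (1 + w₁) * (1 - w₂) * (1 - w₃) * b₁ := by
      linear_combination (norm := noncomm_ring) kb * (1 + w₂) * (1 + w₃)
        + (1 + w₁) * k12 * (1 + w₃) + (1 + w₁) * (1 - w₂) * k13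
    rw [z1, zero_mul] at this
    linear_combination (norm := noncomm_ring) -b₁ * this + sqb * ((1 + w₁) * (1 + w₂) * (1 + w₃))
  have key : w₁ * w₂ * w₃ = -1 := by
    have h4 : (4 : ℝ) • (w₁ * w₂ * w₃) = (4 : ℝ) • (-1 : A) := by
      have e : ∀ x : A, (4 : ℝ) • x = 4 * x := fun x => by
        rw [Algebra.smul_def, map_ofNat]
      rw [e, e]
      have z2' : (1 - w₁) * (1 + w₂) * (1 - w₃) = 0 := by
        linear_combination (norm := noncomm_ring) z2 - h12 * (1 - w₃)
      have z3' : (1 - w₁) * (1 - w₂) * (1 + w₃) = 0 := by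
        linear_combination (norm := noncomm_ring) z3 - h13 * (1 - w₂) - h23 + w₁ * h23
      linear_combination (norm := noncomm_ring) z0 + z1 + z2' + z3'
    exact smul_right_injective A four_ne_zero h4
  linear_combination (norm := noncomm_ring) key * w₃ - w₁ * w₂ * s3

end IsFanoLine

theorem mul_proj_mul {x w₁ w₂ w₃ v₁ v₂ v₃ : A} (hx : x * x = -1) (h₁ : x * w₁ = v₁ * x)
    (h₂ : x * w₂ = v₂ * x) (h₃ : x * w₃ = v₃ * x) :
    x * ((1 - w₁) * (1 - w₂) * (1 - w₃)) * x = -((1 - v₁) * (1 - v₂) * (1 - v₃)) := by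
  linear_combination (norm := noncomm_ring) -h₁ * (1 - w₂) * (1 - w₃) * x
    - (1 - v₁) * h₂ * (1 - w₃) * x - (1 - v₁) * (1 - v₂) * h₃ * x
    + (1 - v₁) * (1 - v₂) * (1 - v₃) * hx

end Clifford

/-! ### Octonion coordinates and the multiplication table -/

namespace Octonion

@[simp] theorem mul_apply_zero (x y : Octonion) : (x * y) 0 =
    x 0 * y 0 - x 1 * y 1 - x 2 * y 2 - x 3 * y 3 - x 4 * y 4 - x 5 * y 5 - x 6 * y 6 - x 7 *
      y 7 := rfl

@[simp] theorem mul_apply_one (x y : Octonion) : (x * y) 1 =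
    x 0 * y 1 + x 1 * y 0 + (x 2 * y 3 - x 3 * y 2) + (x 4 * y 5 - x 5 * y 4) + (x 7 * y 6 - x
      6 * y 7) := rfl

@[simp] theorem mul_apply_two (x y : Octonion) : (x * y) 2 =
    x 0 * y 2 + x 2 * y 0 + (x 3 * y 1 - x 1 * y 3) + (x 4 * y 6 - x 6 * y 4) + (x 5 * y 7 - x
      7 * y 5) := rfl

@[simp] theorem mul_apply_three (x y : Octonion) : (x * y) 3 =
    x 0 * y 3 + x 3 * y 0 + (x 1 * y 2 - x 2 * y 1) + (x 4 * y 7 - x 7 * y 4) + (x 6 * y 5 - x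
      5 * y 6) := rfl

@[simp] theorem mul_apply_four (x y : Octonion) : (x * y) 4 =
    x 0 * y 4 + x 4 * y 0 + (x 5 * y 1 - x 1 * y 5) + (x 6 * y 2 - x 2 * y 6) + (x 7 * y 3 - x
      3 * y 7) := rfl

@[simp] theorem mul_apply_five (x y : Octonion) : (x * y) 5 =
    x 0 * y 5 + x 5 * y 0 + (x 1 * y 4 - x 4 * y 1) + (x 7 * y 2 - x 2 * y 7) + (x 3 * y 6 - x
      6 * y 3) := rfl

@[simp] theorem mul_apply_six (x y : Octonion) : (x * y) 6 =
    x 0 * y 6 + x 6 * y 0 + (x 1 * y 7 - x 7 * y 1) + (x 2 * y 4 - x 4 * y 2) + (x 5 * y 3 - x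
      3 * y 5) := rfl

@[simp] theorem mul_apply_seven (x y : Octonion) : (x * y) 7 =
    x 0 * y 7 + x 7 * y 0 + (x 6 * y 1 - x 1 * y 6) + (x 2 * y 5 - x 5 * y 2) + (x 3 * y 4 - x
      4 * y 3) := rfl

@[simp] theorem add_apply (x y : Octonion) (i : Fin 8) : (x + y) i = x i + y i := rfl

@[simp] theorem sub_apply (x y : Octonion) (i : Fin 8) : (x - y) i = x i - y i := rfl

@[simp] theorem neg_apply (x : Octonion) (i : Fin 8) : (-x) i = -x i := rfl

@[simp] theorem smul_apply (r : ℝ) (x : Octonion) (i : Fin 8) : (r • x) i = r * x i := rfl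

@[simp] theorem e_apply (i j : Fin 8) : e i j = if j = i then 1 else 0 := rfl

@[simp] theorem one_apply (i : Fin 8) : (1 : Octonion) i = if i = 0 then 1 else 0 := rfl

@[simp] theorem conj_apply (x : Octonion) (i : Fin 8) : conj x i = if i = 0 then x i else -x i := rfl

theorem e_zero : e 0 = 1 := rfl

theorem ext_coord {x y : Octonion} (h0 : x 0 = y 0) (h1 : x 1 = y 1) (h2 : x 2 = y 2)
    (h3 : x 3 = y 3) (h4 : x 4 = y 4) (h5 : x 5 = y 5) (h6 : x 6 = y 6) (h7 : x 7 = y 7) :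
    x = y := by
  funext i
  fin_cases i <;> assumption

theorem e_mul_self {i : Fin 8} (hi : i ≠ 0) : e i * e i = -1 := by
  fin_cases i <;> first | exact absurd rfl hi | skip
  all_goals apply ext_coord <;> simp

theorem mul_add_mul_swap (x y : Octonion) :
    x * y + y * x = (2 * x 0) • y + (2 * y 0) • x - (2 * ∑ i, x i * y i) • (1 : Octonion) := by
  apply ext_coord <;> simp [Fin.sum_univ_eight] <;> ring

theorem e_mul_e_swap {i j : Fin 8} (hi : i ≠ 0) (hj : j ≠ 0) (hij : i ≠ j) :
    e i * e j = -(e j * e i) := by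
  refine eq_neg_of_add_eq_zero_left ?_
  rw [mul_add_mul_swap]
  simp [hi.symm, hj.symm, hij.symm]

/-- Imaginary units `p, q, t` multiplying like the quaternions `i, j, k`. -/
structure IsTriple (p q t : Octonion) : Prop where
  sq_left : p * p = -1
  sq_mid : q * q = -1
  sq_right : t * t = -1
  left_mid : p * q = t
  mid_right : q * t = p
  right_left : t * p = q
  mid_left : q * p = -t
  right_mid : t * q = -p
  left_right : p * t = -q

theorem IsTriple.rotate {p q t : Octonion} (h : IsTriple p q t) : IsTriple q t p :=
  ⟨h.sq_mid, h.sq_right, h.sq_left, h.mid_right, h.right_left, h.left_mid, h.right_mid,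
    h.left_right, h.mid_left⟩

theorem isTriple_123 : IsTriple (e 1) (e 2) (e 3) := by
  constructor <;> apply ext_coord <;> simp

theorem isTriple_145 : IsTriple (e 1) (e 4) (e 5) := by
  constructor <;> apply ext_coord <;> simp

theorem isTriple_176 : IsTriple (e 1) (e 7) (e 6) := by
  constructor <;> apply ext_coord <;> simp

theorem isTriple_246 : IsTriple (e 2) (e 4) (e 6) := by
  constructor <;> apply ext_coord <;> simp

theorem isTriple_257 : IsTriple (e 2) (e 5) (e 7) := by
  constructor <;> apply ext_coord <;> simp

theorem isTriple_347 : IsTriple (e 3) (e 4) (e 7) := by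
  constructor <;> apply ext_coord <;> simp

theorem isTriple_365 : IsTriple (e 3) (e 6) (e 5) := by
  constructor <;> apply ext_coord <;> simp

theorem sum_smul_e (x : Octonion) : ∑ i, x i • e i = x := by
  simp only [Fin.sum_univ_eight]
  apply ext_coord <;> simp

/-- Associators span the imaginary octonions. -/
theorem map_eq_re_smul {V : Type*} [AddCommGroup V] [Module ℝ V] (f : Octonion →ₗ[ℝ] V)
    (hf : ∀ x y z : Octonion, f (x * y * z) = f (x * (y * z))) (p : Octonion) :
    f p = re p • f 1 := by
  have key : ∀ i j k l : Fin 8, e i * e j * e k = -(e i * (e j * e k)) →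
      e i * e j * e k = e l → f (e l) = 0 := by
    intro i j k l h1 h2
    have h := hf (e i) (e j) (e k)
    rw [← neg_eq_iff_eq_neg.2 h1, map_neg, h2] at h
    have h3 : (2 : ℝ) • f (e l) = 0 := by
      rw [two_smul]
      nth_rewrite 1 [h]
      exact neg_add_cancel _
    simpa using h3
  -- Each imaginary unit is a product of three units not on a common line, which anti-associate.
  have h1 : f (e 1) = 0 := key 4 2 7 1 ?_ ?_
  have h2 : f (e 2) = 0 := key 1 4 7 2 ?_ ?_
  have h3 : f (e 3) = 0 := key 4 1 6 3 ?_ ?_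
  have h4 : f (e 4) = 0 := key 2 1 7 4 ?_ ?_
  have h5 : f (e 5) = 0 := key 1 2 6 5 ?_ ?_
  have h6 : f (e 6) = 0 := key 2 1 5 6 ?_ ?_
  have h7 : f (e 7) = 0 := key 1 2 4 7 ?_ ?_
  · conv_lhs => rw [← sum_smul_e p]
    simp [Fin.sum_univ_eight, h1, h2, h3, h4, h5, h6, h7, e_zero, re]
  all_goals apply ext_coord <;> simp

end Octonion

/-! ### Associating vectors and the Fano plane -/

noncomputable section

namespace OctonionBimodule

open Octonion

variable {M : Type*} [AddCommGroup M] [Module ℝ M] [OctonionBimodule M]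

/-- Left multiplication by `p` as an endomorphism. -/
def leftEnd (M : Type*) [AddCommGroup M] [Module ℝ M] [OctonionBimodule M] (p : Octonion) :
    Module.End ℝ M := lmul p

/-- Right multiplication by `p` as an endomorphism. -/
def rightEnd (M : Type*) [AddCommGroup M] [Module ℝ M] [OctonionBimodule M] (p : Octonion) :
    Module.End ℝ M := rmul.flip p

theorem leftEnd_apply (p : Octonion) (x : M) : leftEnd M p x = p •ₗ x := rfl

theorem lmul_self (p : Octonion) (x : M) : (p * p) •ₗ x = p •ₗ (p •ₗ x) := by
  have h := left_alternating p p x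
  have h3 : (2 : ℝ) • ((p * p) •ₗ x - p •ₗ (p •ₗ x)) = 0 := by
    rw [two_smul]
    nth_rewrite 1 [h]
    exact neg_add_cancel _
  exact sub_eq_zero.1 (by simpa using h3)

theorem rmul_self (p : Octonion) (x : M) : (x •ᵣ p) •ᵣ p = x •ᵣ (p * p) := by
  have h := left_eq_right p p x
  rw [lmul_self, sub_self] at h
  exact sub_eq_zero.1 h.symm

theorem rmul_lmul_self (p : Octonion) (x : M) : (p •ₗ x) •ᵣ p = p •ₗ (x •ᵣ p) := by
  have h := left_eq_middle p p x
  rw [lmul_self, sub_self] at h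
  exact sub_eq_zero.1 h.symm

theorem leftEnd_mul_self {p : Octonion} (hp : p * p = -1) :
    leftEnd M p * leftEnd M p = -1 := by
  ext x
  have h := lmul_self p x
  rw [hp, map_neg, LinearMap.neg_apply, one_lmul] at h
  exact h.symm

theorem rightEnd_mul_self {p : Octonion} (hp : p * p = -1) :
    rightEnd M p * rightEnd M p = -1 := by
  ext x
  have h := rmul_self p x
  rw [hp, map_neg, rmul_one] at h
  exact h

theorem leftEnd_anticomm {p q : Octonion} (h : p * q = -(q * p)) :
    leftEnd M p * leftEnd M q = -(leftEnd M q * leftEnd M p) := by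
  ext x
  have h2 := left_alternating p q x
  rw [h, map_neg, LinearMap.neg_apply] at h2
  change p •ₗ (q •ₗ x) = -(q •ₗ (p •ₗ x))
  rw [← sub_eq_zero] at h2
  rw [← sub_eq_zero, ← neg_eq_zero, ← h2]
  abel

theorem rightEnd_commutator (p q : Octonion) :
    rightEnd M p * leftEnd M q - leftEnd M q * rightEnd M p =
      leftEnd M (p * q) - leftEnd M p * leftEnd M q := by
  ext x
  exact (left_eq_middle p q x).symm

theorem leftEnd_neg (p : Octonion) : leftEnd M (-p) = -leftEnd M p := by
  simp [leftEnd]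

theorem isFanoLine {p q t : Octonion} (h : IsTriple p q t) :
    IsFanoLine (rightEnd M p) (leftEnd M p) (leftEnd M q) (leftEnd M t) where
  sq_a := leftEnd_mul_self h.sq_left
  sq_b := leftEnd_mul_self h.sq_mid
  sq_c := leftEnd_mul_self h.sq_right
  ab := leftEnd_anticomm (by rw [h.left_mid, h.mid_left, neg_neg])
  ac := leftEnd_anticomm (by rw [h.left_right, h.right_left])
  bc := leftEnd_anticomm (by rw [h.mid_right, h.right_mid, neg_neg])
  sq_r := rightEnd_mul_self h.sq_left
  ra := by
    ext x
    exact rmul_lmul_self p x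
  rb := by rw [rightEnd_commutator, h.left_mid]
  rc := by rw [rightEnd_commutator, h.left_right, leftEnd_neg]

/-- `p` and `q` associate with `x`. -/
def Associate (p q : Octonion) (x : M) : Prop := (p * q) •ₗ x = p •ₗ (q •ₗ x)

theorem Associate.swap {p q : Octonion} {x : M} (h : Associate p q x) : Associate q p x := by
  have h2 := left_alternating q p x
  rw [Associate] at *
  rw [h, sub_self, neg_zero] at h2
  exact sub_eq_zero.1 h2

theorem lmul_lmul_of_sq {p : Octonion} (hp : p * p = -1) (x : M) : p •ₗ (p •ₗ x) = -x :=
  LinearMap.congr_fun (leftEnd_mul_self hp) x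

theorem lmul_lmul_swap {p q : Octonion} (h : p * q = -(q * p)) (x : M) :
    p •ₗ (q •ₗ x) = -(q •ₗ (p •ₗ x)) :=
  LinearMap.congr_fun (leftEnd_anticomm h) x

variable {p q t : Octonion} {x : M}

theorem Associate.rotate (h : IsTriple p q t) (hx : Associate p q x) : Associate q t x := by
  rw [Associate, h.left_mid] at hx
  rw [Associate, h.mid_right, hx, lmul_lmul_swap (p := q) (q := p)
    (by rw [h.left_mid, h.mid_left]), lmul_lmul_of_sq h.sq_mid, map_neg, neg_neg]

theorem Associate.lmul_eq_neg (h : IsTriple p q t) (hx : Associate p q x) :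
    (leftEnd M p * leftEnd M q * leftEnd M t) x = -x := by
  have h2 := hx.rotate h
  rw [Associate, h.mid_right] at h2
  change p •ₗ (q •ₗ (t •ₗ x)) = -x
  rw [← h2, lmul_lmul_of_sq h.sq_left]

theorem associate_of_lmul_eq_neg (h : IsTriple p q t)
    (hx : (leftEnd M p * leftEnd M q * leftEnd M t) x = -x) : Associate p q x := by
  have h2 : Associate q t x := by
    have := congrArg (fun y => p •ₗ y) hx
    change p •ₗ (p •ₗ (q •ₗ (t •ₗ x))) = p •ₗ (-x) at this
    rw [lmul_lmul_of_sq h.sq_left, map_neg] at this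
    rw [Associate, h.mid_right]
    exact (neg_injective this).symm
  exact (h2.rotate h.rotate).rotate h.rotate.rotate

/-- Two lines of the Fano plane determine the third line through their common point. -/
theorem associate_third_line {f : Fin 8 → Fin 8} (hf : Function.Injective f) (hf0 : f 0 = 0)
    (h₁ : IsTriple (e (f 1)) (e (f 2)) (e (f 3))) (h₂ : IsTriple (e (f 1)) (e (f 4)) (e (f 5)))
    (h₃ : IsTriple (e (f 1)) (e (f 6)) (e (f 7)))
    (hx₁ : Associate (e (f 1)) (e (f 2)) x) (hx₂ : Associate (e (f 1)) (e (f 4)) x) :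
    Associate (e (f 1)) (e (f 6)) x := by
  refine associate_of_lmul_eq_neg h₃ ?_
  have key : ∀ i j : Fin 8, i ≠ 0 → j ≠ 0 → i ≠ j → leftEnd M (e (f i)) * leftEnd M (e (f j)) =
      -(leftEnd M (e (f j)) * leftEnd M (e (f i))) := fun i j hi hj hij =>
    leftEnd_anticomm (e_mul_e_swap (fun h => hi (hf (h.trans hf0.symm)))
      (fun h => hj (hf (h.trans hf0.symm))) (hf.ne hij))
  have h := (isFanoLine (M := M) h₁).mul_eq_neg (isFanoLine h₂) (isFanoLine h₃)
    (key _ _ (by decide) (by decide) (by decide)) (key _ _ (by decide) (by decide) (by decide))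
    (key _ _ (by decide) (by decide) (by decide)) (key _ _ (by decide) (by decide) (by decide))
    (key _ _ (by decide) (by decide) (by decide)) (key _ _ (by decide) (by decide) (by decide))
    (key _ _ (by decide) (by decide) (by decide)) (key _ _ (by decide) (by decide) (by decide))
    (key _ _ (by decide) (by decide) (by decide)) (key _ _ (by decide) (by decide) (by decide))
    (key _ _ (by decide) (by decide) (by decide)) (key _ _ (by decide) (by decide) (by decide))
  have h4 := LinearMap.congr_fun h x
  rw [Module.End.mul_apply, hx₂.lmul_eq_neg h₂, map_neg, hx₁.lmul_eq_neg h₁, neg_neg,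
    LinearMap.neg_apply] at h4
  rw [← neg_neg ((leftEnd M (e (f 1)) * _ * _) x), ← h4]

theorem mem_realPart_iff {u : M} : u ∈ realPart M ↔ ∀ p q : Octonion, Associate p q u := by
  simp only [realPart, Set.mem_ofPred_eq, Associate, sub_eq_zero]

theorem mem_realPart_of_associate_e (h : ∀ i j, Associate (e i) (e j) x) : x ∈ realPart M := by
  rw [mem_realPart_iff]
  intro p q
  have mul_sum : ∀ a b : Octonion, a * b = ∑ i, ∑ j, (a i * b j) • (e i * e j) := by
    intro a b
    simp only [Fin.sum_univ_eight]
    apply ext_coord <;> simp <;> ring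
  rw [Associate, mul_sum p q]
  conv_rhs => rw [← sum_smul_e p, ← sum_smul_e q]
  simp only [map_sum, map_smul, LinearMap.sum_apply, LinearMap.smul_apply, Finset.smul_sum,
    mul_smul]
  rw [Finset.sum_comm]
  refine Finset.sum_congr rfl fun i _ => Finset.sum_congr rfl fun j _ => ?_
  rw [h j i, smul_comm]

theorem mem_realPart_of_three_lines (h₁ : Associate (e 1) (e 2) x)
    (h₂ : Associate (e 1) (e 4) x) (h₃ : Associate (e 2) (e 4) x) : x ∈ realPart M := by
  have r : ∀ {p q t : Octonion}, IsTriple p q t → Associate p q x →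
      Associate p q x ∧ Associate q p x ∧ Associate q t x ∧ Associate t q x ∧
      Associate t p x ∧ Associate p t x := fun h hx =>
    ⟨hx, hx.swap, hx.rotate h, (hx.rotate h).swap, (hx.rotate h).rotate h.rotate,
      ((hx.rotate h).rotate h.rotate).swap⟩
  have h23 := h₁.rotate isTriple_123
  have h45 := h₂.rotate isTriple_145
  have h4 : Associate (e 1) (e 7) x := associate_third_line (f := ![0, 1, 2, 3, 4, 5, 7, 6])
    (by decide) rfl isTriple_123 isTriple_145 isTriple_176 h₁ h₂
  have h5 : Associate (e 2) (e 5) x := associate_third_line (f := ![0, 2, 3, 1, 4, 6, 5, 7])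
    (by decide) rfl isTriple_123.rotate isTriple_246 isTriple_257 h23 h₃
  have h6 : Associate (e 4) (e 7) x := associate_third_line (f := ![0, 4, 5, 1, 6, 2, 7, 3])
    (by decide) rfl isTriple_145.rotate isTriple_246.rotate isTriple_347.rotate
    h45 (h₃.rotate isTriple_246)
  have h34 : Associate (e 3) (e 4) x := (h6.rotate isTriple_347.rotate).rotate
    isTriple_347.rotate.rotate
  have h7 : Associate (e 3) (e 6) x := associate_third_line (f := ![0, 3, 4, 7, 1, 2, 6, 5])
    (by decide) rfl isTriple_347 isTriple_123.rotate.rotate isTriple_365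
    h34 (h23.rotate isTriple_123.rotate)
  have g0 : ∀ j, Associate (e 0) (e j) x := fun j => by
    have : (1 : Octonion) * e j = e j := by apply ext_coord <;> simp
    rw [Associate, e_zero, this, one_lmul]
  have g0s : ∀ j, Associate (e j) (e 0) x := fun j => (g0 j).swap
  have gd : ∀ j, Associate (e j) (e j) x := fun j => lmul_self _ _
  generalize hG : (fun i j => Associate (e i) (e j) x) = G
  have hG' : ∀ i j, Associate (e i) (e j) x = G i j := fun i j => congrFun₂ hG i j
  obtain ⟨a1, a2, a3, a4, a5, a6⟩ := r isTriple_123 h₁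
  obtain ⟨b1, b2, b3, b4, b5, b6⟩ := r isTriple_145 h₂
  obtain ⟨c1, c2, c3, c4, c5, c6⟩ := r isTriple_176 h4
  obtain ⟨d1, d2, d3, d4, d5, d6⟩ := r isTriple_246 h₃
  obtain ⟨f1, f2, f3, f4, f5, f6⟩ := r isTriple_257 h5
  obtain ⟨k1, k2, k3, k4, k5, k6⟩ := r isTriple_347 h34
  obtain ⟨l1, l2, l3, l4, l5, l6⟩ := r isTriple_365 h7
  refine mem_realPart_of_associate_e fun i j => ?_
  simp only [hG'] at *
  fin_cases i <;> fin_cases j <;> first | exact g0 _ | exact g0s _ | exact gd _ | assumption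

end OctonionBimodule

end

/-! ### Decomposition of a bimodule over its real part -/

noncomputable section

namespace OctonionBimodule

open Octonion

variable {M : Type*} [AddCommGroup M] [Module ℝ M] [OctonionBimodule M]

/-- The product of the left multiplications by three basis octonions. -/
def lineEnd (M : Type*) [AddCommGroup M] [Module ℝ M] [OctonionBimodule M] (i j k : Fin 8) :
    Module.End ℝ M := leftEnd M (e i) * leftEnd M (e j) * leftEnd M (e k)

theorem leftEnd_mul_lineEnd {i j k l : Fin 8} (hi : i ≠ 0) (hj : j ≠ 0) (hk : k ≠ 0) (hl : l ≠ 0)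
    (hli : l ≠ i) (hlj : l ≠ j) (hlk : l ≠ k) :
    leftEnd M (e l) * lineEnd M i j k = -lineEnd M i j k * leftEnd M (e l) := by
  rw [neg_mul]
  exact anticomm_mul_mul (leftEnd_anticomm (e_mul_e_swap hl hi hli))
    (leftEnd_anticomm (e_mul_e_swap hl hj hlj)) (leftEnd_anticomm (e_mul_e_swap hl hk hlk))

theorem leftEnd_mul_lineEnd_left {i j k : Fin 8} (h : IsTriple (e i) (e j) (e k)) :
    leftEnd M (e i) * lineEnd M i j k = lineEnd M i j k * leftEnd M (e i) :=
  (isFanoLine h).a_comm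

theorem leftEnd_mul_lineEnd_mid {i j k : Fin 8} (h : IsTriple (e i) (e j) (e k)) :
    leftEnd M (e j) * lineEnd M i j k = lineEnd M i j k * leftEnd M (e j) :=
  (isFanoLine h).b_comm

theorem leftEnd_mul_lineEnd_right {i j k : Fin 8} (h : IsTriple (e i) (e j) (e k)) :
    leftEnd M (e k) * lineEnd M i j k = lineEnd M i j k * leftEnd M (e k) :=
  (isFanoLine h).c_comm

/-- Eight times the projection to the real part. -/
def realEnd (M : Type*) [AddCommGroup M] [Module ℝ M] [OctonionBimodule M] : Module.End ℝ M :=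
  (1 - lineEnd M 1 2 3) * (1 - lineEnd M 1 4 5) * (1 - lineEnd M 2 4 6)

theorem realEnd_mem (x : M) : realEnd M x ∈ realPart M := by
  have s1 := (isFanoLine (M := M) isTriple_123).sq
  have s2 := (isFanoLine (M := M) isTriple_145).sq
  have s3 := (isFanoLine (M := M) isTriple_246).sq
  have a21 : leftEnd M (e 4) * lineEnd M 1 2 3 = _ := leftEnd_mul_lineEnd
    (by decide) (by decide) (by decide) (by decide) (by decide) (by decide) (by decide)
  have a22 : leftEnd M (e 5) * lineEnd M 1 2 3 = _ := leftEnd_mul_lineEnd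
    (by decide) (by decide) (by decide) (by decide) (by decide) (by decide) (by decide)
  have a23 : leftEnd M (e 6) * lineEnd M 1 2 3 = _ := leftEnd_mul_lineEnd
    (by decide) (by decide) (by decide) (by decide) (by decide) (by decide) (by decide)
  have a24 : leftEnd M (e 2) * lineEnd M 1 4 5 = _ := leftEnd_mul_lineEnd
    (by decide) (by decide) (by decide) (by decide) (by decide) (by decide) (by decide)
  have a25 : leftEnd M (e 6) * lineEnd M 1 4 5 = _ := leftEnd_mul_lineEnd
    (by decide) (by decide) (by decide) (by decide) (by decide) (by decide) (by decide)
  have b1 := leftEnd_mul_lineEnd_left (M := M) isTriple_123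
  have b2 := leftEnd_mul_lineEnd_mid (M := M) isTriple_123
  have b4 := leftEnd_mul_lineEnd_mid (M := M) isTriple_145
  have c12 : lineEnd M 1 4 5 * lineEnd M 1 2 3 = lineEnd M 1 2 3 * lineEnd M 1 4 5 := by
    rw [lineEnd.eq_1 M 1 4 5]
    linear_combination (norm := noncomm_ring) leftEnd M (e 1) * leftEnd M (e 4) * a22
      - leftEnd M (e 1) * a21 * leftEnd M (e 5) + b1 * leftEnd M (e 4) * leftEnd M (e 5)
  have c13 : lineEnd M 2 4 6 * lineEnd M 1 2 3 = lineEnd M 1 2 3 * lineEnd M 2 4 6 := by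
    rw [lineEnd.eq_1 M 2 4 6]
    linear_combination (norm := noncomm_ring) leftEnd M (e 2) * leftEnd M (e 4) * a23
      - leftEnd M (e 2) * a21 * leftEnd M (e 6) + b2 * leftEnd M (e 4) * leftEnd M (e 6)
  have c23 : lineEnd M 2 4 6 * lineEnd M 1 4 5 = lineEnd M 1 4 5 * lineEnd M 2 4 6 := by
    rw [lineEnd.eq_1 M 2 4 6]
    linear_combination (norm := noncomm_ring) leftEnd M (e 2) * leftEnd M (e 4) * a25
      - leftEnd M (e 2) * b4 * leftEnd M (e 6) - a24 * leftEnd M (e 4) * leftEnd M (e 6)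
  change lineEnd M 1 2 3 * lineEnd M 1 2 3 = 1 at s1
  change lineEnd M 1 4 5 * lineEnd M 1 4 5 = 1 at s2
  change lineEnd M 2 4 6 * lineEnd M 2 4 6 = 1 at s3
  -- The three involutions commute, so each factor 1 - w can be brought to the front, where w(1 - w)
  -- = -(1 - w).
  have p1 : lineEnd M 1 2 3 * realEnd M = -realEnd M := by
    rw [realEnd]
    linear_combination (norm := noncomm_ring) -s1 * (1 - lineEnd M 1 4 5) * (1 - lineEnd M 2 4 6)
  have p2 : lineEnd M 1 4 5 * realEnd M = -realEnd M := by
    rw [realEnd]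
    linear_combination (norm := noncomm_ring)
      -c12 * (1 - lineEnd M 1 4 5) * (1 - lineEnd M 2 4 6)
        - (1 - lineEnd M 1 2 3) * s2 * (1 - lineEnd M 2 4 6)
  have p3 : lineEnd M 2 4 6 * realEnd M = -realEnd M := by
    rw [realEnd]
    linear_combination (norm := noncomm_ring)
      -c13 * (1 - lineEnd M 1 4 5) * (1 - lineEnd M 2 4 6)
        - (1 - lineEnd M 1 2 3) * c23 * (1 - lineEnd M 2 4 6)
        - (1 - lineEnd M 1 2 3) * (1 - lineEnd M 1 4 5) * s3
  exact mem_realPart_of_three_lines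
    (associate_of_lmul_eq_neg isTriple_123 (LinearMap.congr_fun p1 x))
    (associate_of_lmul_eq_neg isTriple_145 (LinearMap.congr_fun p2 x))
    (associate_of_lmul_eq_neg isTriple_246 (LinearMap.congr_fun p3 x))

/-- Conjugation by eᵢ flips the sign of w for precisely those of the three lines that miss i. The
seven units realize the seven nontrivial sign patterns, and the product ∏(1 ± w) summed over all
eight patterns is 8. -/
theorem realEnd_sub_sum : realEnd M - (leftEnd M (e 1) * realEnd M * leftEnd M (e 1)
    + leftEnd M (e 2) * realEnd M * leftEnd M (e 2)
    + leftEnd M (e 3) * realEnd M * leftEnd M (e 3)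
    + leftEnd M (e 4) * realEnd M * leftEnd M (e 4)
    + leftEnd M (e 5) * realEnd M * leftEnd M (e 5)
    + leftEnd M (e 6) * realEnd M * leftEnd M (e 6)
    + leftEnd M (e 7) * realEnd M * leftEnd M (e 7)) = 8 := by
  have sq : ∀ i : Fin 8, i ≠ 0 → leftEnd M (e i) * leftEnd M (e i) = -1 := fun i hi =>
    leftEnd_mul_self (e_mul_self hi)
  have h1 := mul_proj_mul (sq 1 (by decide)) (leftEnd_mul_lineEnd_left isTriple_123)
    (leftEnd_mul_lineEnd_left isTriple_145) (leftEnd_mul_lineEnd (i := 2) (j := 4) (k := 6)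
    (by decide) (by decide) (by decide) (by decide) (by decide) (by decide) (by decide))
  have h2 := mul_proj_mul (sq 2 (by decide)) (leftEnd_mul_lineEnd_mid isTriple_123)
    (leftEnd_mul_lineEnd (i := 1) (j := 4) (k := 5)
    (by decide) (by decide) (by decide) (by decide) (by decide) (by decide) (by decide))
    (leftEnd_mul_lineEnd_left isTriple_246)
  have h3 := mul_proj_mul (sq 3 (by decide)) (leftEnd_mul_lineEnd_right isTriple_123)
    (leftEnd_mul_lineEnd (i := 1) (j := 4) (k := 5)
    (by decide) (by decide) (by decide) (by decide) (by decide) (by decide) (by decide))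
    (leftEnd_mul_lineEnd (i := 2) (j := 4) (k := 6)
    (by decide) (by decide) (by decide) (by decide) (by decide) (by decide) (by decide))
  have h4 := mul_proj_mul (sq 4 (by decide)) (leftEnd_mul_lineEnd (i := 1) (j := 2) (k := 3)
    (by decide) (by decide) (by decide) (by decide) (by decide) (by decide) (by decide))
    (leftEnd_mul_lineEnd_mid isTriple_145) (leftEnd_mul_lineEnd_mid isTriple_246)
  have h5 := mul_proj_mul (sq 5 (by decide)) (leftEnd_mul_lineEnd (i := 1) (j := 2) (k := 3)
    (by decide) (by decide) (by decide) (by decide) (by decide) (by decide) (by decide))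
    (leftEnd_mul_lineEnd_right isTriple_145) (leftEnd_mul_lineEnd (i := 2) (j := 4) (k := 6)
    (by decide) (by decide) (by decide) (by decide) (by decide) (by decide) (by decide))
  have h6 := mul_proj_mul (sq 6 (by decide)) (leftEnd_mul_lineEnd (i := 1) (j := 2) (k := 3)
    (by decide) (by decide) (by decide) (by decide) (by decide) (by decide) (by decide))
    (leftEnd_mul_lineEnd (i := 1) (j := 4) (k := 5)
    (by decide) (by decide) (by decide) (by decide) (by decide) (by decide) (by decide))
    (leftEnd_mul_lineEnd_right isTriple_246)
  have h7 := mul_proj_mul (sq 7 (by decide)) (leftEnd_mul_lineEnd (i := 1) (j := 2) (k := 3)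
    (by decide) (by decide) (by decide) (by decide) (by decide) (by decide) (by decide))
    (leftEnd_mul_lineEnd (i := 1) (j := 4) (k := 5)
    (by decide) (by decide) (by decide) (by decide) (by decide) (by decide) (by decide))
    (leftEnd_mul_lineEnd (i := 2) (j := 4) (k := 6)
    (by decide) (by decide) (by decide) (by decide) (by decide) (by decide) (by decide))
  rw [realEnd, h1, h2, h3, h4, h5, h6, h7]
  noncomm_ring
  simp

theorem smul_mem_realPart (r : ℝ) {u : M} (hu : u ∈ realPart M) : r • u ∈ realPart M := by
  rw [mem_realPart_iff] at *
  intro p q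
  rw [Associate, map_smul, map_smul, map_smul, hu p q]

/-- A bimodule is spanned by the octonion multiples of its real elements. -/
theorem exists_eq_sum_lmul (x : M) :
    ∃ u : Fin 8 → M, (∀ i, u i ∈ realPart M) ∧ x = ∑ i, e i •ₗ u i := by
  refine ⟨fun i => if i = 0 then (1 / 8 : ℝ) • realEnd M x
    else (-1 / 8 : ℝ) • realEnd M (e i •ₗ x), fun i => ?_, ?_⟩
  · dsimp only
    split_ifs <;> exact smul_mem_realPart _ (realEnd_mem _)
  · have h := LinearMap.congr_fun (realEnd_sub_sum (M := M)) x
    have h8 : (8 : Module.End ℝ M) x = (8 : ℝ) • x := by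
      rw [← map_ofNat (algebraMap ℝ (Module.End ℝ M)) 8, Module.algebraMap_end_apply]
    simp only [h8, LinearMap.sub_apply, LinearMap.add_apply, Module.End.mul_apply,
      leftEnd_apply] at h
    have h9 : x = (1 / 8 : ℝ) • (8 : ℝ) • x := by rw [smul_smul]; norm_num
    conv_lhs => rw [h9, ← h]
    simp [Fin.sum_univ_eight, e_zero, one_lmul]
    module

variable {u : M} (hu : u ∈ realPart M)
include hu

theorem mul_lmul_of_mem (p q : Octonion) : (p * q) •ₗ u = p •ₗ (q •ₗ u) :=
  mem_realPart_iff.1 hu p q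

theorem rmul_rmul_of_mem (p q : Octonion) : (u •ᵣ p) •ᵣ q = u •ᵣ (p * q) := by
  have h := left_eq_right p q u
  rw [mul_lmul_of_mem hu, sub_self] at h
  exact sub_eq_zero.1 h.symm

theorem lmul_rmul_of_mem (p q : Octonion) : (p •ₗ u) •ᵣ q = p •ₗ (u •ᵣ q) := by
  have h := left_eq_middle q p u
  rw [mul_lmul_of_mem hu, sub_self] at h
  exact sub_eq_zero.1 h.symm

/-- Real elements commute with the octonions. -/
theorem lmul_eq_rmul_of_mem (p : Octonion) : p •ₗ u = u •ᵣ p := by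
  have key := map_eq_re_smul ((lmul.flip u) - (rmul u)) (fun x y z => ?_) p
  · simp only [LinearMap.sub_apply, LinearMap.flip_apply, one_lmul, rmul_one, sub_self,
      smul_zero] at key
    exact sub_eq_zero.1 key
  -- Associators [x, y, z] commute with u: [x, y, z]u = [x, y, zu] = [y, zu, x] = [y, z, ux] = [ux,
  -- y, z] = u[x, y, z]. They span the imaginary octonions.
  · simp only [LinearMap.sub_apply, LinearMap.flip_apply]
    have h1 := left_eq_right y z (u •ᵣ x)
    have h2 := left_eq_middle x y (z •ₗ u)
    rw [← mul_lmul_of_mem hu y z, lmul_rmul_of_mem hu, lmul_rmul_of_mem hu, h1,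
      mul_lmul_of_mem hu y z, ← mul_lmul_of_mem hu (x * y) z, ← mul_lmul_of_mem hu y z,
      ← mul_lmul_of_mem hu x (y * z)] at h2
    simp only [rmul_rmul_of_mem hu] at h2
    rw [sub_eq_sub_iff_add_eq_add] at h2 ⊢
    rw [h2, add_comm]

end OctonionBimodule

end

/-! ### Trace identities and the projection to the real part -/

noncomputable section

namespace Octonion

theorem conj_mul (x y : Octonion) : conj (x * y) = conj y * conj x := by
  apply ext_coord <;> simp <;> ring

theorem conj_eq_neg {x : Octonion} (h : re x = 0) : conj x = -x := by
  have h0 : x 0 = 0 := h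
  apply ext_coord <;> simp [h0]

theorem re_conj_mul_swap (x p : Octonion) : re (conj x * p) = re (x * conj p) := by
  simp [re]

/-- The sum of eᵢpeᵢ over i ≥ 1 is -7 for p = 1 and 5p for an imaginary unit p (six terms p, one
term -p), which explains 5/12 and 1/12. -/
theorem sum_e_mul_mul_e (p : Octonion) : (5 / 12 : ℝ) • p
    - (1 / 12 : ℝ) • ∑ i ∈ Finset.univ.erase (0 : Fin 8), (e i * p) * e i = re p • 1 := by
  have h : Finset.univ.erase (0 : Fin 8) = {1, 2, 3, 4, 5, 6, 7} := by decide
  rw [h]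
  simp only [Finset.sum_insert, Finset.mem_insert, Finset.mem_singleton, Finset.sum_singleton,
    Fin.reduceEq, or_self, not_false_eq_true]
  apply ext_coord <;> simp [re] <;> ring

theorem isReal_iff (c : Octonion) : IsReal c ↔ ∀ k : Octonion, re k = 0 → re (c * k) = 0 := by
  constructor
  · rintro ⟨r, rfl⟩ k hk
    have h0 : k 0 = 0 := hk
    simp [re, h0]
  · intro h
    have h1 := h (e 1) (by simp [re])
    have h2 := h (e 2) (by simp [re])
    have h3 := h (e 3) (by simp [re])
    have h4 := h (e 4) (by simp [re])
    have h5 := h (e 5) (by simp [re])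
    have h6 := h (e 6) (by simp [re])
    have h7 := h (e 7) (by simp [re])
    simp only [re, mul_apply_zero, e_apply] at h1 h2 h3 h4 h5 h6 h7
    refine ⟨re c, ?_⟩
    apply ext_coord <;> simp_all [re]

theorem e_one_mem_unitImaginary : e 1 ∈ unitImaginary := by
  constructor <;> simp [re, abs]

theorem eq_re_add_im (r : Octonion) : ∃ k, re k = 0 ∧ r = re r • (1 : Octonion) + k := by
  refine ⟨r - re r • 1, ?_, by abel⟩
  simp [re]

/-- The real part as a linear map. -/
def reLin : Octonion →ₗ[ℝ] ℝ where
  toFun := re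
  map_add' _ _ := rfl
  map_smul' _ _ := rfl

end Octonion

namespace OctonionBimodule

open Octonion

variable {M : Type*} [AddCommGroup M] [Module ℝ M] [OctonionBimodule M]

theorem zero_mem_realPart : (0 : M) ∈ realPart M := by
  simp [mem_realPart_iff, Associate]

theorem add_mem_realPart {u v : M} (hu : u ∈ realPart M) (hv : v ∈ realPart M) :
    u + v ∈ realPart M := by
  rw [mem_realPart_iff] at *
  intro p q
  simp only [Associate, map_add]
  rw [hu p q, hv p q]

theorem lmul_rmul_eq_of_mem {u : M} (hu : u ∈ realPart M) (p q : Octonion) :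
    (p •ₗ u) •ᵣ q = (p * q) •ₗ u := by
  rw [lmul_rmul_of_mem hu, ← lmul_eq_rmul_of_mem hu, mul_lmul_of_mem hu]

theorem reProj_add (x y : M) : reProj (x + y) = reProj x + reProj y := by
  simp only [reProj, map_add, LinearMap.add_apply, Finset.sum_add_distrib]
  module

theorem reProj_lmul_of_mem {u : M} (hu : u ∈ realPart M) (p : Octonion) :
    reProj (p •ₗ u) = re p • u := by
  simp only [reProj, ← mul_lmul_of_mem hu, lmul_rmul_eq_of_mem hu]
  have h := congrArg (fun a => a •ₗ u) (sum_e_mul_mul_e p)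
  simpa only [map_sub, map_smul, map_sum, LinearMap.sub_apply, LinearMap.smul_apply,
    LinearMap.sum_apply, one_lmul] using h

@[elab_as_elim]
theorem realPart_induction {C : M → Prop} (x : M) (add : ∀ x y, C x → C y → C (x + y))
    (rmul : ∀ u ∈ realPart M, ∀ p : Octonion, C (u •ᵣ p)) : C x := by
  obtain ⟨u, hu, rfl⟩ := exists_eq_sum_lmul x
  have h : ∀ i, C (e i •ₗ u i) := fun i => by
    rw [lmul_eq_rmul_of_mem (hu i)]
    exact rmul _ (hu i) _
  rw [Fin.sum_univ_eight]
  exact add _ _ (add _ _ (add _ _ (add _ _ (add _ _ (add _ _ (add _ _ (h 0) (h 1)) (h 2)) (h 3))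
    (h 4)) (h 5)) (h 6)) (h 7)

end OctonionBimodule

/-! ### The real inner product and para-linear operators -/

namespace PreHilbertOctonionBimodule

open Octonion OctonionBimodule

variable {H : Type*} [NormedAddCommGroup H] [NormedSpace ℝ H] [PreHilbertOctonionBimodule H]

/-- The real part of the inner product, as a bilinear form. -/
def rip (H : Type*) [NormedAddCommGroup H] [NormedSpace ℝ H] [PreHilbertOctonionBimodule H] :
    H →ₗ[ℝ] H →ₗ[ℝ] ℝ := oinner.compr₂ reLin

theorem rip_apply (x y : H) : rip H x y = re ⟪x, y⟫ₒ := rfl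

theorem rip_comm (x y : H) : rip H x y = rip H y x := by
  rw [rip_apply, oinner_conj]
  simp [rip_apply, re]

theorem re_oinner_mul (x y : H) (p : Octonion) : re (⟪x, y⟫ₒ * p) = rip H x (y •ᵣ p) :=
  (re_sub_eq_zero_iff _ _).1 (oinner_paraLinear _ _ _)

theorem rip_rmul_left (x y : H) (p : Octonion) :
    rip H (x •ᵣ p) y = rip H x (y •ᵣ conj p) := by
  rw [rip_comm, ← re_oinner_mul, oinner_conj, re_conj_mul_swap, re_oinner_mul]

theorem rip_self_eq_zero {x : H} (h : rip H x x = 0) : x = 0 := by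
  rw [rip_apply, oinner_self] at h
  simpa [re] using h

/-- As a functional of p the left side kills associators: move the factors of v((xy)z) across to u
one at a time, regroup them there, and move them back as v(x(yz)). -/
theorem rip_rmul_of_mem {u v : H} (hu : u ∈ realPart H) (hv : v ∈ realPart H) (p : Octonion) :
    rip H u (v •ᵣ p) = re p * rip H u v := by
  have h := map_eq_re_smul ((rip H u).comp (OctonionBimodule.rmul v)) (fun x y z => ?_) p
  · simpa [rmul_one] using h
  · simp only [LinearMap.comp_apply]
    rw [← rmul_rmul_of_mem hv, ← rmul_rmul_of_mem hv, ← conj_conj z, ← rip_rmul_left,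
      ← conj_conj y, ← rip_rmul_left, ← conj_conj x, ← rip_rmul_left]
    rw [rmul_rmul_of_mem hu, rmul_rmul_of_mem hu, rip_rmul_left]
    simp only [conj_mul, conj_conj]

theorem rip_reProj {v : H} (hv : v ∈ realPart H) (w : H) : rip H (reProj w) v = rip H w v := by
  induction w using realPart_induction with
  | add x y hx hy => rw [reProj_add, map_add, map_add, LinearMap.add_apply, LinearMap.add_apply,
      hx, hy]
  | rmul u hu p =>
    rw [rip_rmul_left, rip_rmul_of_mem hu hv, ← lmul_eq_rmul_of_mem hu, reProj_lmul_of_mem hu]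
    simp [re]

section ParaLinear

variable {T : H →L[ℝ] H} (hT : IsRightParaLinear T)
include hT

theorem rip_map_rmul {v : H} (hv : v ∈ realPart H) (x : H) (p : Octonion) :
    rip H (T x •ᵣ p) v = rip H (T (x •ᵣ p)) v := by
  have h := rip_reProj hv (secondAssoc T p x)
  rw [hT.2, map_zero, LinearMap.zero_apply, secondAssoc, map_sub, LinearMap.sub_apply] at h
  exact sub_eq_zero.1 h.symm

theorem rip_map_rmul_rmul {u v : H} (hu : u ∈ realPart H) (hv : v ∈ realPart H)
    (p q : Octonion) :
    rip H (T (u •ᵣ p)) (v •ᵣ q) = rip H (T (u •ᵣ (p * conj q))) v := by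
  rw [← rmul_rmul_of_mem hu, ← rip_map_rmul hT hv, rip_rmul_left, conj_conj]

/-- On generators up and vq the two sides are B(u, pq̄, v) and B(v, qp̄, u), and qp̄ is the
conjugate of pq̄. -/
theorem symmetric_of_realPart (h : ∀ u ∈ realPart H, ∀ v ∈ realPart H, ∀ r : Octonion,
    rip H (T (u •ᵣ r)) v = rip H (T (v •ᵣ conj r)) u) (x y : H) :
    rip H (T x) y = rip H x (T y) := by
  induction x using realPart_induction with
  | add x x' hx hx' => simp only [map_add, LinearMap.add_apply, hx, hx']
  | rmul u hu p =>
    induction y using realPart_induction with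
    | add y y' hy hy' => simp only [map_add, hy, hy']
    | rmul v hv q =>
      rw [rip_map_rmul_rmul hT hu hv, h u hu v hv, rip_comm (u •ᵣ p),
        rip_map_rmul_rmul hT hv hu, conj_mul, conj_conj]

theorem rip_map_slice {u v : H} (hu : u ∈ realPart H) (hv : v ∈ realPart H) (J k : Octonion) :
    rip H (T (u + J •ₗ v)) ((u + J •ₗ v) •ᵣ k) =
      rip H (T (u •ᵣ conj k)) u + rip H (T (u •ᵣ conj (J * k))) v
        + rip H (T (v •ᵣ (J * conj k))) u + rip H (T (v •ᵣ (J * conj (J * k)))) v := by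
  have one_mul' : ∀ a : Octonion, 1 * a = a := fun a => by apply ext_coord <;> simp
  have h1 := rip_map_rmul_rmul hT hu hu 1 k
  have h2 := rip_map_rmul_rmul hT hu hv 1 (J * k)
  rw [rmul_one, one_mul'] at h1 h2
  rw [lmul_eq_rmul_of_mem hv, ← rip_map_rmul_rmul hT hv hu, ← rip_map_rmul_rmul hT hv hv,
    ← h1, ← h2]
  simp only [map_add, LinearMap.add_apply, rmul_rmul_of_mem hv]
  ring

end ParaLinear

/-- Only the summand i = 0 of the regular composition has a real part, so the corrected adjoint is
the real Hilbert space adjoint. -/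
theorem rip_octAdjoint [CompleteSpace H] (T : H →L[ℝ] H) (x y : H) :
    rip H x (octAdjoint T y) = rip H (T x) y := by
  rw [rip_apply, oinner_octAdjoint, tripleAssoc, add_sub_cancel, rip_comm, rip_apply]
  have h0 : conj (e 0) = 1 := by apply ext_coord <;> simp
  have h1 : re ⟪y, T x⟫ₒ = re (⟪y, T (x •ᵣ conj (e 0))⟫ₒ) := by rw [h0, rmul_one]
  rw [h1]
  simp [regComp, Fin.sum_univ_eight, re]

theorem isOctSelfAdjoint_iff [CompleteSpace H] (T : H →L[ℝ] H) :
    IsOctSelfAdjoint T ↔ ∀ x y, rip H (T x) y = rip H x (T y) := by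
  constructor
  · intro h x y
    rw [← rip_octAdjoint, ← congrFun h y]
  · intro h
    funext y
    refine sub_eq_zero.1 (rip_self_eq_zero ?_)
    rw [map_sub (rip H (T y - octAdjoint T y)), rip_octAdjoint, h, sub_self]

theorem isReal_oinner_iff (x y : H) :
    IsReal ⟪x, y⟫ₒ ↔ ∀ k : Octonion, re k = 0 → rip H x (y •ᵣ k) = 0 := by
  simp only [isReal_iff, re_oinner_mul]

end PreHilbertOctonionBimodule

end

/-! ### The equivalence -/

theorem mainTheorem1 {H : Type*} [NormedAddCommGroup H] [NormedSpace ℝ H] [CompleteSpace H]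
    [PreHilbertOctonionBimodule H] (T : H →L[ℝ] H)
    (hT : OctonionBimodule.IsRightParaLinear T) :
    PreHilbertOctonionBimodule.IsOctSelfAdjoint T ↔
      ∀ x ∈ OctonionBimodule.sliceCone H, Octonion.IsReal ⟪T x, x⟫ₒ := by
  open Octonion OctonionBimodule PreHilbertOctonionBimodule in
  simp only [isOctSelfAdjoint_iff, isReal_oinner_iff]
  constructor
  · intro hs x hx k hk
    simp only [sliceCone, Set.mem_iUnion, Set.mem_ofPred_eq] at hx
    obtain ⟨J, hJ, u, hu, v, hv, rfl⟩ := hx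
    have hB : ∀ u ∈ realPart H, ∀ v ∈ realPart H, ∀ r : Octonion,
        rip H (T (u •ᵣ r)) v = rip H (T (v •ᵣ conj r)) u := fun u hu v hv r => by
      rw [hs, rip_comm, ← rip_map_rmul hT hu, rip_rmul_left, conj_conj]
    have hI : ∀ u ∈ realPart H, ∀ r : Octonion, re r = 0 → rip H (T (u •ᵣ r)) u = 0 :=
      fun u hu r hr => by
        have h := hB u hu u hu r
        rw [conj_eq_neg hr] at h
        simp only [map_neg, LinearMap.neg_apply] at h
        linarith
    have hk' : re (conj k) = 0 := by simpa [re] using hk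
    -- This real part is |J|² Re k̄.
    have hJk : re (J * conj (J * k)) = 0 := by
      have h1 : J 0 = 0 := hJ.1
      have h2 : k 0 = 0 := hk
      simp [re, h1, h2]
      ring
    rw [rip_map_slice hT hu hv, hI u hu _ hk', hI v hv _ hJk, hB u hu v hv, conj_conj,
      conj_eq_neg hk]
    have hneg : J * -k = -(J * k) := by apply ext_coord <;> simp <;> ring
    simp [hneg]
  · intro h
    -- The single slice J = e₁ already suffices for this direction.
    have key : ∀ u ∈ realPart H, ∀ v ∈ realPart H, ∀ k : Octonion, re k = 0 → _ = (0 : ℝ) :=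
      fun u hu v hv k hk => (rip_map_slice hT hu hv (e 1) k).symm.trans
        (h (u + e 1 •ₗ v) (Set.mem_biUnion e_one_mem_unitImaginary ⟨u, hu, v, hv, rfl⟩) k hk)
    have hI : ∀ u ∈ realPart H, ∀ k : Octonion, re k = 0 → rip H (T (u •ᵣ k)) u = 0 :=
      fun u hu k hk => by
        have h := key u hu 0 zero_mem_realPart k hk
        simpa [conj_eq_neg hk] using h
    refine symmetric_of_realPart hT fun u hu v hv r => ?_
    -- Polarization of the diagonal identity `hI` at u + v.
    have hP : ∀ k : Octonion, re k = 0 → rip H (T (u •ᵣ k)) v = -rip H (T (v •ᵣ k)) u :=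
      fun k hk => by
        have h := hI (u + v) (add_mem_realPart hu hv) k hk
        have h1 := hI u hu k hk
        have h2 := hI v hv k hk
        simp only [map_add, LinearMap.add_apply] at h
        linarith
    -- Taking k = J = e₁ makes Jk = -1, so the cross terms contain no imaginary factor, while the
    -- diagonal terms vanish by `hI`.
    have h1 : rip H (T u) v = rip H (T v) u := by
      have h := key u hu v hv (e 1) (by simp [re])
      have hc : conj (e 1) = -e 1 := conj_eq_neg (by simp [re])
      have e1 : e 1 * e 1 = -1 := e_mul_self (by decide)
      have e2 : conj (-1 : Octonion) = -1 := by apply ext_coord <;> simp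
      have e3 : e 1 * -e 1 = 1 := by apply ext_coord <;> simp
      have e4 : e 1 * -1 = -e 1 := by apply ext_coord <;> simp
      rw [e1, hc, e2, e3, e4] at h
      simp only [map_neg, LinearMap.neg_apply, rmul_one, hI u hu (e 1) (by simp [re]),
        hI v hv (e 1) (by simp [re])] at h
      linarith
    obtain ⟨k, hk, hr⟩ := eq_re_add_im r
    have hc : conj r = re r • (1 : Octonion) - k := by
      have h2 : k 0 = 0 := hk
      rw [hr]
      apply ext_coord <;> simp [re, h2]
    rw [hc]
    conv_lhs => rw [hr]
    simp only [map_add, map_sub, map_smul, LinearMap.add_apply, LinearMap.sub_apply,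
      LinearMap.smul_apply, rmul_one, h1, hP k hk]
    ring
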